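/- Let $K$ be an algebraically closed field of characteristic $0$, let $R=K[x_0,\dots,x_n]$, $\mathbb P^n=\operatorname{Proj} R$, and let $r\ge 1$. Let $C\subset\mathbb P^n$ be a rational normal curve of degree $r$, i.e. the image of a closed embedding $j:\mathbb P^1\to\mathbb P^r\to\mathbb P^n$ composed of the Veronese embedding $(t:u)\mapsto(t^r:t^{r-1}u:\dots:u^r)$ and a linear embedding (so $r\le n$). Let $\mathcal I_C$ be the ideal sheaf of $C$, let $a$ be an integer, let $\mathcal L$ be the line bundle on $C$ with $j^*\mathcal L=\mathcal O_{\mathbb P^1}(-r-2+a)$, and let $\mu:\mathcal I_C/\mathcal I_C^2\to\mathcal L$ be a surjective morphism of sheaves of modules. Let $X\subset\mathbb P^n$ be the doubling of $C$ defined by $\mu$, i.e. the closed subscheme whose ideal sheaf satisfies $\mathcal I_C^2\subseteq\mathcal I_X\subseteq\mathcal I_C$ and $\mathcal I_X/\mathcal I_C^2=\ker\mu$. Then the Hilbert polynomial of $X$ is $P_X(t)=2rt+a-r$; that is, $\dim_K (R/I_X)_t=2rt+a-r$ for all sufficiently large integers $t$, where $I_X=\bigoplus_{d} H^0(\mathbb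 P^n,\mathcal I_X(d))\subseteq R$ is the saturated ideal of $X$. Hence the arithmetic genus $g_X$ of $X$, defined by $P_X(t)=dt+1-g_X$ with integers $d$ and $g_X$, equals $r+1-a$. -/

import Mathlib

open AlgebraicGeometry CategoryTheory

universe u

noncomputable section

namespace DoubleRNC

/-! ### Projective space and its standard open sets -/

/-- The grading of `K[x₀, …, xₙ]` by total degree. -/
abbrev grading (K : Type u) [Field K] (n : ℕ) :
    ℕ → Submodule K (MvPolynomial (Fin (n + 1)) K) :=
  MvPolynomial.homogeneousSubmodule (Fin (n + 1)) K

instance (K : Type u) [Field K] (n : ℕ) : GradedAlgebra (grading K n) :=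
  MvPolynomial.gradedAlgebra

/-- Projective space `ℙⁿ = Proj K[x₀, …, xₙ]`. -/
abbrev PSpace (K : Type u) [Field K] (n : ℕ) : Scheme.{u} :=
  Proj (grading K n)

/-- A form of positive degree in `K[x₀, …, xₙ]`. The open sets `D₊(f)`, for such `f`, are
affine and are a basis of the topology of `ℙⁿ`. -/
structure PosForm (K : Type u) [Field K] (n : ℕ) where
  deg : ℕ
  poly : MvPolynomial (Fin (n + 1)) K
  mem : poly ∈ grading K n deg
  pos : 0 < deg

/-- The coordinate `xᵢ` as a form of degree one. -/
abbrev coord (K : Type u) [Field K] (n : ℕ) (i : Fin (n + 1)) : PosForm K n where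
  deg := 1
  poly := MvPolynomial.X i
  mem := MvPolynomial.isHomogeneous_X K i
  pos := Nat.one_pos

section

variable {K : Type u} [Field K] {n : ℕ}

/-- The affine open set `D₊(f) ⊆ ℙⁿ`. -/
abbrev stdOpen (f : PosForm K n) : (PSpace K n).affineOpens :=
  ⟨Proj.basicOpen (grading K n) f.poly,
    Proj.isAffineOpen_basicOpen (grading K n) f.poly f.mem f.pos⟩

theorem stdOpen_le {f g : PosForm K n} (h : f.poly ∣ g.poly) : stdOpen g ≤ stdOpen f :=
  Proj.basicOpen_mono (grading K n) _ _ h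

/-- Restriction `𝒪(D₊(f)) → 𝒪(D₊(g))` of functions on `ℙⁿ`, for `f ∣ g`. -/
def res {f g : PosForm K n} (h : f.poly ∣ g.poly) :
    Γ(PSpace K n, (stdOpen f).1) →+* Γ(PSpace K n, (stdOpen g).1) :=
  ((PSpace K n).presheaf.map (homOfLE (stdOpen_le h)).op).hom

theorem res_mem (I : (PSpace K n).IdealSheafData) {f g : PosForm K n} (h : f.poly ∣ g.poly)
    {s : Γ(PSpace K n, (stdOpen f).1)} (hs : s ∈ I.ideal (stdOpen f)) :
    res h s ∈ I.ideal (stdOpen g) :=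
  (I.map_ideal (stdOpen_le h)).le (Ideal.mem_map_of_mem _ hs)

/-! ### Hilbert polynomial and arithmetic genus of a closed subscheme of `ℙⁿ` -/

/-- `F / xᵢᵈ`, for a form `F` of degree `d`, as a function on `D₊(xᵢ)`. -/
def dehomogenize {d : ℕ} (F : MvPolynomial (Fin (n + 1)) K) (hF : F ∈ grading K n d)
    (i : Fin (n + 1)) : Γ(PSpace K n, (stdOpen (coord K n i)).1) :=
  (Proj.awayToSection (grading K n) (coord K n i).poly).hom
    (HomogeneousLocalization.Away.mk (grading K n) (coord K n i).mem d F
      (by simpa using hF))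

/-- The saturated homogeneous ideal `I_X = ⨁ H⁰(ℙⁿ, 𝓘_X(d))` of a closed subscheme `X` of
`ℙⁿ` given by its ideal sheaf: it is generated by the forms `F`, say of degree `d`, such that
`F / xᵢᵈ` is a section of `𝓘_X` on `D₊(xᵢ)` for every `i`. -/
def saturatedIdeal (X : (PSpace K n).IdealSheafData) : Ideal (MvPolynomial (Fin (n + 1)) K) :=
  Ideal.span {F | ∃ (d : ℕ) (hF : F ∈ grading K n d),
    ∀ i, dehomogenize F hF i ∈ X.ideal (stdOpen (coord K n i))}

/-- The Hilbert function `t ↦ dim_K (R / I_X)_t`; here `(R / I_X)_t` is the image of `R_t`. -/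
def hilbertFunction (X : (PSpace K n).IdealSheafData) (t : ℕ) : ℕ :=
  Module.finrank K
    ((grading K n t).map (Ideal.Quotient.mkₐ K (saturatedIdeal X)).toLinearMap)

/-- `P` is the Hilbert polynomial of `X`: `P(t) = h_X(t)` for `t ≫ 0`. -/
def IsHilbertPolynomial (X : (PSpace K n).IdealSheafData) (P : Polynomial ℚ) : Prop :=
  ∃ N : ℕ, ∀ t : ℕ, N ≤ t → P.eval (t : ℚ) = hilbertFunction X t

/-- Two Hilbert polynomials of the same subscheme are equal. -/
theorem IsHilbertPolynomial.unique {X : (PSpace K n).IdealSheafData} {P Q : Polynomial ℚ}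
    (hP : IsHilbertPolynomial X P) (hQ : IsHilbertPolynomial X Q) : P = Q := by
  obtain ⟨N, hN⟩ := hP
  obtain ⟨M, hM⟩ := hQ
  refine Polynomial.eq_of_infinite_eval_eq P Q
    (((Set.Ici_infinite (max N M)).image (Nat.cast_injective (R := ℚ)).injOn).mono ?_)
  rintro _ ⟨t, ht, rfl⟩
  have ht' : max N M ≤ t := ht
  exact (hN t (le_trans (le_max_left _ _) ht')).trans
    (hM t (le_trans (le_max_right _ _) ht')).symm

/-- `g` is the arithmetic genus of the curve `X`: the Hilbert polynomial of `X` has the form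
`d t + 1 - g`, with integers `d` (the degree) and `g`. -/
def IsArithmeticGenus (X : (PSpace K n).IdealSheafData) (g : ℤ) : Prop :=
  ∃ d : ℤ, IsHilbertPolynomial X
    (Polynomial.C (d : ℚ) * Polynomial.X + Polynomial.C (1 - g : ℚ))

/-! ### Rational normal curves -/

variable {r : ℕ}

/-- The homomorphism `K[x₀, …, xₙ] → K[t, u]`, `xᵢ ↦ ∑ₖ Aᵢₖ t^(r-k) u^k`. When the matrix `A`
is injective, it describes the map `j : ℙ¹ → ℙʳ → ℙⁿ` composed of the Veronese embedding
`(t : u) ↦ (tʳ : tʳ⁻¹u : … : uʳ)` and of the linear embedding with matrix `A`. -/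
def pullback (A : Matrix (Fin (n + 1)) (Fin (r + 1)) K) :
    MvPolynomial (Fin (n + 1)) K →ₐ[K] MvPolynomial (Fin 2) K :=
  MvPolynomial.aeval fun i => ∑ k : Fin (r + 1),
    MvPolynomial.C (A i k) * MvPolynomial.X 0 ^ (r - (k : ℕ)) * MvPolynomial.X 1 ^ (k : ℕ)

/-- The curve `C = j(ℙ¹)` in `ℙⁿ`, as a reduced closed subscheme: the zero set of all forms
which vanish along `j`. -/
def curve (A : Matrix (Fin (n + 1)) (Fin (r + 1)) K) : (PSpace K n).IdealSheafData :=
  Scheme.IdealSheafData.vanishingIdeal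
    ⟨ProjectiveSpectrum.zeroLocus (grading K n) {F | pullback A F = 0},
      ProjectiveSpectrum.isClosed_zeroLocus (grading K n) _⟩

/-! ### The sheaf `𝓛 = j_* 𝒪_{ℙ¹}(b)`

We have `j⁻¹(D₊(f)) = D₊(j^* f)`, so the sections of `j_* 𝒪_{ℙ¹}(b)` on `D₊(f)` are the
elements of degree `b` of the graded ring `K[t, u]_{j^* f}`. -/

/-- The ring `K[t, u]_{j^* f}`. -/
abbrev LocRing (A : Matrix (Fin (n + 1)) (Fin (r + 1)) K) (f : PosForm K n) : Type u :=
  Localization.Away (pullback A f.poly)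

/-- The sections of `j_* 𝒪_{ℙ¹}(b)` on `D₊(f)`: the fractions `p / (j^* f)ᵏ` with `p` a binary
form of degree `b + k · deg (j^* f)`, where `deg (j^* f) = r · deg f`. -/
def twistSections (A : Matrix (Fin (n + 1)) (Fin (r + 1)) K) (b : ℤ) (f : PosForm K n) :
    Set (LocRing A f) :=
  {z | ∃ (k e : ℕ) (p : MvPolynomial (Fin 2) K), p.IsHomogeneous e ∧
    (e : ℤ) = b + k * (r * f.deg) ∧
    z = Localization.mk p (Submonoid.pow (pullback A f.poly) k)}

theorem isUnit_of_dvd (A : Matrix (Fin (n + 1)) (Fin (r + 1)) K) {f g : PosForm K n}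
    (h : f.poly ∣ g.poly) :
    IsUnit (algebraMap (MvPolynomial (Fin 2) K) (LocRing A g) (pullback A f.poly)) :=
  isUnit_of_dvd_unit (map_dvd _ (map_dvd (pullback A) h))
    (IsLocalization.Away.algebraMap_isUnit (pullback A g.poly))

/-- The restriction map `K[t, u]_{j^* f} → K[t, u]_{j^* g}`, for `f ∣ g`. -/
def locRes (A : Matrix (Fin (n + 1)) (Fin (r + 1)) K) {f g : PosForm K n}
    (h : f.poly ∣ g.poly) : LocRing A f →+* LocRing A g :=
  IsLocalization.Away.lift (pullback A f.poly) (isUnit_of_dvd A h)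

/-- The comorphism `𝒪_{ℙⁿ}(D₊(f)) = (R_f)₀ → K[t, u]_{j^* f}` of `j`; through it
`j_* 𝒪_{ℙ¹}(b)` is a sheaf of modules over `𝒪_{ℙⁿ}`. -/
def comorphism (A : Matrix (Fin (n + 1)) (Fin (r + 1)) K) (f : PosForm K n) :
    Γ(PSpace K n, (stdOpen f).1) →+* LocRing A f :=
  ((Localization.awayMap (pullback A).toRingHom f.poly).comp
    (algebraMap (HomogeneousLocalization.Away (grading K n) f.poly)
      (Localization.Away f.poly))).comp
    (Proj.basicOpenIsoAway (grading K n) f.poly f.mem f.pos).inv.hom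

/-! ### Ferrand's construction -/

/-- A morphism of sheaves of modules `μ : 𝓘_C / 𝓘_C² → 𝓛 = j_* 𝒪_{ℙ¹}(b)`, given on the basis
of affine open sets `D₊(f)`. -/
structure ConormalMap (A : Matrix (Fin (n + 1)) (Fin (r + 1)) K) (b : ℤ) where
  /-- the map on sections over `D₊(f)`, linear over `𝒪(D₊(f))` -/
  app : ∀ f : PosForm K n,
    ((curve A).ideal (stdOpen f)).Cotangent →ₛₗ[comorphism A f] LocRing A f
  /-- its values are sections of `j_* 𝒪_{ℙ¹}(b)` -/
  app_mem : ∀ f s, app f s ∈ twistSections A b f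
  /-- it commutes with restrictions -/
  naturality : ∀ {f g : PosForm K n} (h : f.poly ∣ g.poly) (s)
    (hs : s ∈ (curve A).ideal (stdOpen f)),
    app g (Ideal.toCotangent _ ⟨res h s, res_mem (curve A) h hs⟩) =
      locRes A h (app f (Ideal.toCotangent _ ⟨s, hs⟩))

variable {A : Matrix (Fin (n + 1)) (Fin (r + 1)) K} {b : ℤ}

/-- Surjectivity of the morphism of sheaves `μ`: every section of `𝓛` lifts locally. -/
def ConormalMap.IsSurjective (μ : ConormalMap A b) : Prop :=
  ∀ (f : PosForm K n), ∀ z ∈ twistSections A b f, ∀ x ∈ (stdOpen f).1,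
    ∃ (g : PosForm K n) (h : f.poly ∣ g.poly),
      x ∈ (stdOpen g).1 ∧ ∃ s, μ.app g s = locRes A h z

/-- `X` is the closed subscheme of `ℙⁿ` defined by `μ`: `𝓘_C² ⊆ 𝓘_X ⊆ 𝓘_C` and
`𝓘_X / 𝓘_C² = ker μ`. -/
def ConormalMap.Defines (μ : ConormalMap A b) (X : (PSpace K n).IdealSheafData) : Prop :=
  ∀ (f : PosForm K n) (s : Γ(PSpace K n, (stdOpen f).1)),
    s ∈ X.ideal (stdOpen f) ↔
      ∃ hs : s ∈ (curve A).ideal (stdOpen f), μ.app f (Ideal.toCotangent _ ⟨s, hs⟩) = 0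

end

end DoubleRNC

end

/-! Write b = a - r - 2, let I_C be the kernel of `pullback A`, and let S = K[t,u]. For a form F of
degree d in I_C, the local elements (j^*x_i)^d μ(F/x_i^d) agree on overlaps. The j^*x_i have no
common factor, so these elements come from a single binary form, which is zero or of degree b + rd.
This gives linear maps (I_C)_d → S_{b+rd} (`exists_lifts`, `liftMap`) whose kernel is (I_X)_d
(`mem_saturatedIdeal`). The map R_d → S_{rd} is onto for every d (`exists_pullback_eq`), so
(R/I_C)_d has dimension rd + 1. For large d the map (I_C)_d → S_{b+rd} is onto as well
(`exists_forall_exists_lifts`), so its image has dimension b + rd + 1. The two dimensions add up to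
2rd + b + 2 = 2rd + a - r. The second surjectivity is proved by hand, without cohomology. For fixed
z, the forms h such that j^*h · z is induced by a form in I_C generate a homogeneous ideal. Local
surjectivity of μ puts every variable in its radical (`X_mem_radical`), so it contains all forms of
large degree. Finitely many monomials z then suffice. -/

noncomputable section

namespace DoubleRNC

/-! ### Functions on D₊(f) as fractions -/

section Sections

variable {K : Type u} [Field K] {n : ℕ}

/-- The fraction `F / fᵏ` as a function on `D₊(f)`. -/
def frac (f : PosForm K n) (k : ℕ) (F : MvPolynomial (Fin (n + 1)) K)
    (hF : F ∈ grading K n (k • f.deg)) : Γ(PSpace K n, (stdOpen f).1) :=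
  (Proj.awayToSection (grading K n) f.poly).hom
    (HomogeneousLocalization.Away.mk (grading K n) f.mem k F hF)

theorem exists_frac (f : PosForm K n) (s : Γ(PSpace K n, (stdOpen f).1)) :
    ∃ k F hF, s = frac f k F hF := by
  obtain ⟨k, F, hF, h⟩ := HomogeneousLocalization.Away.mk_surjective (grading K n) f.mem
    ((Proj.basicOpenIsoAway (grading K n) f.poly f.mem f.pos).inv.hom s)
  refine ⟨k, F, hF, ?_⟩
  exact (congr((Proj.basicOpenIsoAway (grading K n) f.poly f.mem f.pos).hom.hom $h).trans
    (Iso.inv_hom_id_apply (Proj.basicOpenIsoAway (grading K n) f.poly f.mem f.pos) s)).symm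

/-- The value of a function on `D₊(f)` in the local ring of a point. -/
def valueAt (f : PosForm K n) (s : Γ(PSpace K n, (stdOpen f).1))
    (x : ProjectiveSpectrum (grading K n)) (hx : f.poly ∉ x.asHomogeneousIdeal) :
    HomogeneousLocalization.AtPrime (grading K n) x.asHomogeneousIdeal.toIdeal :=
  s.1 ⟨x, hx⟩

/-- Sections of the structure sheaf of Proj are by construction families of elements of the
homogeneous local rings, and these embed in ordinary localizations. Identities of sections thus
become identities of fractions. -/
theorem ext_valueAt {f : PosForm K n} {s t : Γ(PSpace K n, (stdOpen f).1)}
    (h : ∀ x hx, (valueAt f s x hx).val = (valueAt f t x hx).val) : s = t := by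
  apply Subtype.ext
  funext x
  exact HomogeneousLocalization.val_injective _ (h x.1 x.2)

theorem valueAt_mul {f : PosForm K n} (s t : Γ(PSpace K n, (stdOpen f).1)) (x hx) :
    valueAt f (s * t) x hx = valueAt f s x hx * valueAt f t x hx := rfl

theorem valueAt_add {f : PosForm K n} (s t : Γ(PSpace K n, (stdOpen f).1)) (x hx) :
    valueAt f (s + t) x hx = valueAt f s x hx + valueAt f t x hx := rfl

theorem valueAt_res {f g : PosForm K n} (h : f.poly ∣ g.poly)
    (s : Γ(PSpace K n, (stdOpen f).1)) (x hx) :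
    valueAt g (res h s) x hx =
      valueAt f s x fun hf => hx (Ideal.mem_of_dvd x.asHomogeneousIdeal.toIdeal h hf) := rfl

theorem val_valueAt_frac (f : PosForm K n) (k F hF) (x : ProjectiveSpectrum (grading K n)) (hx) :
    (valueAt f (frac f k F hF) x hx).val = Localization.mk F
      (⟨f.poly ^ k, pow_mem (S := x.asHomogeneousIdeal.toIdeal.primeCompl) hx k⟩ :
        x.asHomogeneousIdeal.toIdeal.primeCompl) := by
  refine (ProjectiveSpectrum.Proj.awayToSection_apply (grading K n) f.poly
    (HomogeneousLocalization.Away.mk (grading K n) f.mem k F hF) ⟨x, hx⟩).trans ?_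
  rw [HomogeneousLocalization.Away.val_mk, Localization.mk_eq_mk', IsLocalization.map_mk',
    Localization.mk_eq_mk']
  rfl

theorem isUnit_valueAt_frac (f : PosForm K n) (k F hF) (x : ProjectiveSpectrum (grading K n))
    (hx) : IsUnit (valueAt f (frac f k F hF) x hx) ↔ F ∉ x.asHomogeneousIdeal := by
  rw [← HomogeneousLocalization.isUnit_iff_isUnit_val, val_valueAt_frac, Localization.mk_eq_mk',
    IsLocalization.AtPrime.isUnit_mk'_iff _ x.asHomogeneousIdeal.toIdeal]
  rfl

theorem mem_basicOpen_frac (f : PosForm K n) (k F hF) (x : PSpace K n)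
    (hx : x ∈ (stdOpen f).1) :
    x ∈ (PSpace K n).basicOpen (frac f k F hF) ↔
      F ∉ (show ProjectiveSpectrum (grading K n) from x).asHomogeneousIdeal := by
  rw [Scheme.mem_basicOpen _ _ _ hx, ← isUnit_valueAt_frac f k F hF x hx]
  have h : Proj.stalkIso' (grading K n) x ((PSpace K n).presheaf.germ _ x hx (frac f k F hF)) =
      valueAt f (frac f k F hF) x hx :=
    Proj.stalkIso'_germ (grading K n) _ x hx (frac f k F hF)
  rw [← h]
  exact (MulEquiv.isUnit_map (Proj.stalkIso' (grading K n) x)).symm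

theorem comorphism_frac {r : ℕ} (A : Matrix (Fin (n + 1)) (Fin (r + 1)) K) (f : PosForm K n)
    (k F hF) : comorphism A f (frac f k F hF) =
      Localization.mk (pullback A F) (Submonoid.pow (pullback A f.poly) k) := by
  have h : (Proj.basicOpenIsoAway (grading K n) f.poly f.mem f.pos).inv.hom (frac f k F hF) =
      HomogeneousLocalization.Away.mk (grading K n) f.mem k F hF := by
    have : frac f k F hF = (Proj.basicOpenIsoAway (grading K n) f.poly f.mem f.pos).hom.hom
      (HomogeneousLocalization.Away.mk (grading K n) f.mem k F hF) := rfl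
    rw [this]
    exact Iso.hom_inv_id_apply (Proj.basicOpenIsoAway (grading K n) f.poly f.mem f.pos) _
  rw [comorphism, RingHom.comp_apply, RingHom.comp_apply, h,
    HomogeneousLocalization.algebraMap_apply, HomogeneousLocalization.Away.val_mk,
    Localization.awayMap, IsLocalization.Away.map, Localization.mk_eq_mk', IsLocalization.map_mk',
    Localization.mk_eq_mk']
  congr 1
  exact Subtype.ext (map_pow _ _ _)

theorem frac_add (f : PosForm K n) (k F G hF hG) :
    frac f k F hF + frac f k G hG = frac f k (F + G) (add_mem hF hG) := by
  apply ext_valueAt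
  intro x hx
  rw [valueAt_add, HomogeneousLocalization.val_add, val_valueAt_frac, val_valueAt_frac,
    val_valueAt_frac, Localization.add_mk_self]

/-- Identities between functions with different denominators reduce to the cross-multiplied
polynomial identity `e`. -/
theorem frac_mul_res {f g : PosForm K n} (h : f.poly ∣ g.poly) {k l m : ℕ} {H F G}
    (hH hF hG) (e : H * F * g.poly ^ m = G * (g.poly ^ k * f.poly ^ l)) :
    frac g k H hH * res h (frac f l F hF) = frac g m G hG := by
  apply ext_valueAt
  intro x hx
  rw [valueAt_mul, valueAt_res, HomogeneousLocalization.val_mul, val_valueAt_frac,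
    val_valueAt_frac, val_valueAt_frac, Localization.mk_mul,
    Localization.mk_eq_mk_iff, Localization.r_iff_exists]
  refine ⟨1, ?_⟩
  simp only [OneMemClass.coe_one, one_mul, Submonoid.coe_mul]
  linear_combination e

end Sections

/-! ### Graded ideals and fractions in polynomial rings -/

section Graded

variable {K σ : Type*} [Field K]

attribute [local instance] MvPolynomial.gradedAlgebra

theorem coe_decompose_eq_homogeneousComponent (q : MvPolynomial σ K) (d : ℕ) :
    (DirectSum.decompose (MvPolynomial.homogeneousSubmodule σ K) q d : MvPolynomial σ K) =
      MvPolynomial.homogeneousComponent d q :=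
  MvPolynomial.decomposition.decompose'_apply q d

theorem homogeneousComponent_mul_of_isHomogeneous {h : MvPolynomial σ K} {m : ℕ}
    (hh : h.IsHomogeneous m) (d : ℕ) (q : MvPolynomial σ K) :
    MvPolynomial.homogeneousComponent (d + m) (q * h) =
      MvPolynomial.homogeneousComponent d q * h := by
  rw [← coe_decompose_eq_homogeneousComponent, ← coe_decompose_eq_homogeneousComponent]
  exact DirectSum.coe_decompose_mul_add_of_right_mem (MvPolynomial.homogeneousSubmodule σ K)
    ((MvPolynomial.mem_homogeneousSubmodule m h).2 hh)

theorem homogeneousComponent_mul_of_lt {h : MvPolynomial σ K} {m : ℕ}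
    (hh : h.IsHomogeneous m) {d : ℕ} (hd : d < m) (q : MvPolynomial σ K) :
    MvPolynomial.homogeneousComponent d (q * h) = 0 := by
  rw [← coe_decompose_eq_homogeneousComponent]
  exact DirectSum.coe_decompose_mul_of_right_mem_of_not_le
    (MvPolynomial.homogeneousSubmodule σ K)
    ((MvPolynomial.mem_homogeneousSubmodule m h).2 hh) (not_le.2 hd)

/-- The component of q h in degree d + m is q_d h, and h can be cancelled, so only q_{e-m} survives.
-/
theorem exists_isHomogeneous_of_mul {q h : MvPolynomial σ K} {m e : ℕ} (hh : h.IsHomogeneous m)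
    (h0 : h ≠ 0) (hqh : (q * h).IsHomogeneous e) :
    q = 0 ∨ ∃ d, d + m = e ∧ q.IsHomogeneous d := by
  by_cases hq : q = 0
  · exact Or.inl hq
  have key : ∀ d, d + m ≠ e → MvPolynomial.homogeneousComponent d q = 0 := by
    intro d hd
    have := homogeneousComponent_mul_of_isHomogeneous hh d q
    rw [MvPolynomial.homogeneousComponent_of_mem hqh, if_neg hd] at this
    exact (mul_eq_zero.1 this.symm).resolve_right h0
  have hm : m ≤ e := by
    by_contra hm
    refine hq ?_
    rw [← MvPolynomial.sum_homogeneousComponent q]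
    exact Finset.sum_eq_zero fun d _ => key d (by omega)
  refine Or.inr ⟨e - m, by omega, ?_⟩
  rw [← MvPolynomial.sum_homogeneousComponent q]
  refine MvPolynomial.IsHomogeneous.sum _ _ _ fun d _ => ?_
  by_cases hd : d + m = e
  · obtain rfl : d = e - m := by omega
    exact MvPolynomial.homogeneousComponent_isHomogeneous _ _
  · rw [key d hd]
    exact MvPolynomial.isHomogeneous_zero _ _ _

/-- If `V m` is the degree `m` part of a homogeneous ideal, for all `m`, then the ideal generated
by the `V m` has `V m` as degree `m` part. -/
theorem mem_of_mem_span {V : ℕ → Submodule K (MvPolynomial σ K)}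
    (hV : ∀ m, V m ≤ MvPolynomial.homogeneousSubmodule σ K m)
    (hmul : ∀ k m h F, h ∈ MvPolynomial.homogeneousSubmodule σ K k → F ∈ V m →
      h * F ∈ V (k + m))
    {m : ℕ} {F : MvPolynomial σ K} (hF : F.IsHomogeneous m)
    (hs : F ∈ Ideal.span {F | ∃ d, F ∈ V d}) : F ∈ V m := by
  have key : ∀ G ∈ Ideal.span {F | ∃ d, F ∈ V d}, ∀ m,
      MvPolynomial.homogeneousComponent m G ∈ V m := by
    intro G hG
    refine Submodule.span_induction ?_ ?_ ?_ ?_ hG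
    · rintro G ⟨d, hd⟩ m
      rw [MvPolynomial.homogeneousComponent_of_mem (hV d hd)]
      split_ifs with h
      · exact h ▸ hd
      · exact zero_mem _
    · intro m
      rw [map_zero]
      exact zero_mem _
    · intro G H _ _ hG hH m
      rw [map_add]
      exact add_mem (hG m) (hH m)
    · intro a G _ hG m
      rw [smul_eq_mul, ← MvPolynomial.sum_homogeneousComponent G, Finset.mul_sum, map_sum]
      refine sum_mem fun d _ => ?_
      by_cases hd : d ≤ m
      · obtain ⟨k, rfl⟩ := Nat.exists_eq_add_of_le' hd
        rw [homogeneousComponent_mul_of_isHomogeneous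
          (MvPolynomial.homogeneousComponent_isHomogeneous d G)]
        exact hmul _ _ _ _ (MvPolynomial.homogeneousComponent_mem _ _) (hG d)
      · rw [homogeneousComponent_mul_of_lt
          (MvPolynomial.homogeneousComponent_isHomogeneous d G) (not_le.1 hd)]
        exact zero_mem _
  have := key F hs m
  rwa [MvPolynomial.homogeneousComponent_of_mem hF, if_pos rfl] at this

/-- A homogeneous ideal which contains a power of each variable contains all forms of large
degree. -/
theorem mem_of_X_pow_mem [Fintype σ] {J : Ideal (MvPolynomial σ K)} {m M : ℕ}
    (hJ : ∀ i, MvPolynomial.X i ^ m ∈ J) (hM : Fintype.card σ * m < M)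
    {F : MvPolynomial σ K} (hF : F.IsHomogeneous M) : F ∈ J := by
  rw [F.as_sum]
  refine sum_mem fun d hd => ?_
  have hdeg : d.degree = M := by
    by_contra h
    exact MvPolynomial.mem_support_iff.1 hd (hF.coeff_eq_zero h)
  obtain ⟨i, hi⟩ : ∃ i, m ≤ d i := by
    by_contra! h
    rw [Finsupp.degree_eq_sum] at hdeg
    have : ∑ i, d i ≤ ∑ _i : σ, m := Finset.sum_le_sum fun i _ => (h i).le
    simp at this
    omega
  refine Ideal.mem_of_dvd J ?_ (hJ i)
  rw [MvPolynomial.X_pow_eq_monomial, MvPolynomial.monomial_dvd_monomial]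
  exact ⟨Or.inr (by simpa using hi), one_dvd _⟩

/-- Fractions `pᵢ / yᵢᵏ` which agree are equal to a polynomial, if the `yᵢ` have no
common factor. -/
theorem exists_eq_mul_pow_of_agree {S ι : Type*} [CommRing S] [IsDomain S]
    [UniqueFactorizationMonoid S] (y p : ι → S) (k : ι → ℕ) (i₀ : ι) (h₀ : y i₀ ≠ 0)
    (hy : ∀ π, Irreducible π → ∃ i, ¬ π ∣ y i)
    (h : ∀ i j, y i ≠ 0 → y j ≠ 0 → p i * y j ^ k j = p j * y i ^ k i) :
    ∃ q, ∀ i, y i ≠ 0 → p i = q * y i ^ k i := by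
  -- Put p_{i₀} / y_{i₀}^k in lowest terms b/a. An irreducible factor π of a fails to divide some
  -- y_j; comparing with the fraction at j forces π to divide b, which is excluded. So a is a unit.
  obtain ⟨a, b, c, hab, ha, hb⟩ := UniqueFactorizationMonoid.exists_reduced_factors
    (y i₀ ^ k i₀) (pow_ne_zero _ h₀) (p i₀)
  have hc : c ≠ 0 := by
    rintro rfl
    exact pow_ne_zero _ h₀ (by rw [← ha, zero_mul])
  have hu : IsUnit a := by
    by_contra hu
    have ha0 : a ≠ 0 := by
      rintro rfl
      exact pow_ne_zero _ h₀ (by rw [← ha, mul_zero])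
    obtain ⟨π, hπ, hπa⟩ := WfDvdMonoid.exists_irreducible_factor hu ha0
    obtain ⟨j, hj⟩ := hy π hπ
    have e := h i₀ j h₀ fun h => hj (h ▸ dvd_zero _)
    have e' : b * y j ^ k j = p j * a := by
      apply mul_left_cancel₀ hc
      rw [← ha, ← hb] at e
      linear_combination e
    have hd : π ∣ b * y j ^ k j := e' ▸ hπa.mul_left _
    rcases hπ.prime.dvd_or_dvd hd with hd | hd
    · exact hπ.not_isUnit (hab hπa hd)
    · exact hj (hπ.prime.dvd_of_dvd_pow hd)
  obtain ⟨v, hv⟩ := hu.exists_right_inv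
  have e₀ : p i₀ = b * v * y i₀ ^ k i₀ := by
    rw [← ha, ← hb]
    linear_combination (-(c * b)) * hv
  refine ⟨b * v, fun i hi => ?_⟩
  have e := h i₀ i h₀ hi
  apply mul_right_cancel₀ (pow_ne_zero (k i₀) h₀)
  rw [← e, e₀]
  ring

end Graded

/-! ### Binary forms -/

section Binary

variable {K : Type*} [Field K]

theorem mem_of_binary_monomials {m : ℕ} {W : Submodule K (MvPolynomial (Fin 2) K)}
    (h : ∀ a b, a + b = m → (MvPolynomial.X 0 ^ a * MvPolynomial.X 1 ^ b) ∈ W)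
    {p : MvPolynomial (Fin 2) K} (hp : p.IsHomogeneous m) : p ∈ W := by
  rw [p.as_sum]
  refine sum_mem fun d hd => ?_
  have hdeg : d.degree = m := by
    by_contra h
    exact MvPolynomial.mem_support_iff.1 hd (hp.coeff_eq_zero h)
  rw [MvPolynomial.monomial_eq, Finsupp.prod_fintype _ _ (by simp), Fin.prod_univ_two,
    MvPolynomial.C_mul']
  refine W.smul_mem _ (h _ _ ?_)
  rw [← hdeg, Finsupp.degree_eq_sum, Fin.sum_univ_two]

theorem isHomogeneous_binary_monomial (a b : ℕ) :
    (MvPolynomial.X 0 ^ a * MvPolynomial.X 1 ^ b : MvPolynomial (Fin 2) K).IsHomogeneous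
      (a + b) :=
  (MvPolynomial.isHomogeneous_X_pow 0 a).mul (MvPolynomial.isHomogeneous_X_pow 1 b)

/-- The exponents of degree `m` in two variables. -/
def binaryExponents (m : ℕ) : {d : Fin 2 →₀ ℕ | d.degree = m} ≃ Fin (m + 1) where
  toFun d := ⟨d.1 0, by
    have := d.2
    rw [Set.mem_ofPred_eq, Finsupp.degree_eq_sum, Fin.sum_univ_two] at this
    omega⟩
  invFun i := ⟨Finsupp.equivFunOnFinite.symm ![(i : ℕ), m - i], by
    rw [Set.mem_ofPred_eq, Finsupp.degree_eq_sum, Fin.sum_univ_two]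
    simp
    omega⟩
  left_inv d := by
    have := d.2
    rw [Set.mem_ofPred_eq, Finsupp.degree_eq_sum, Fin.sum_univ_two] at this
    apply Subtype.ext
    ext i
    fin_cases i
    · simp
    · simp
      omega
  right_inv i := by simp

theorem finrank_binary_forms (m : ℕ) :
    Module.finrank K (MvPolynomial.homogeneousSubmodule (Fin 2) K m) = m + 1 := by
  rw [MvPolynomial.homogeneousSubmodule_eq_finsupp_supported]
  have := Fintype.ofEquiv _ (binaryExponents m).symm
  rw [(AddMonoidAlgebra.supportedEquivFinsupp {d : Fin 2 →₀ ℕ | d.degree = m}).finrank_eq,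
    Module.finrank_finsupp_self, Fintype.card_congr (binaryExponents m), Fintype.card_fin]

end Binary

/-! ### The ideal of the curve and its projective normality -/

section Curve

variable {K : Type u} [Field K] {n r : ℕ} (A : Matrix (Fin (n + 1)) (Fin (r + 1)) K)

theorem pullback_isHomogeneous {F : MvPolynomial (Fin (n + 1)) K} {d : ℕ}
    (hF : F ∈ grading K n d) : (pullback A F).IsHomogeneous (r * d) := by
  refine MvPolynomial.IsHomogeneous.aeval hF _ fun i => ?_
  refine MvPolynomial.IsHomogeneous.sum _ _ _ fun k _ => ?_
  rw [mul_assoc]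
  refine MvPolynomial.IsHomogeneous.C_mul ?_ _
  have := isHomogeneous_binary_monomial (K := K) (r - k) k
  rwa [Nat.sub_add_cancel (Nat.lt_succ_iff.1 k.2)] at this

/-- `pullback A` multiplies degrees by r, and r ≥ 1 keeps distinct degrees distinct. -/
theorem homogeneousComponent_pullback (hr : 1 ≤ r) (d : ℕ) (F : MvPolynomial (Fin (n + 1)) K) :
    MvPolynomial.homogeneousComponent (r * d) (pullback A F) =
      pullback A (MvPolynomial.homogeneousComponent d F) := by
  conv_lhs => rw [← MvPolynomial.sum_homogeneousComponent F, map_sum, map_sum]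
  have key : ∀ e, MvPolynomial.homogeneousComponent (r * d)
      (pullback A (MvPolynomial.homogeneousComponent e F)) =
      if e = d then pullback A (MvPolynomial.homogeneousComponent d F) else 0 := by
    intro e
    rw [MvPolynomial.homogeneousComponent_of_mem
      (pullback_isHomogeneous A (MvPolynomial.homogeneousComponent_mem e F))]
    by_cases h : e = d
    · simp [h]
    · rw [if_neg h, if_neg]
      intro h'
      exact h (Nat.eq_of_mul_eq_mul_left hr h').symm
  simp_rw [key]
  rw [Finset.sum_ite_eq']
  split_ifs with h
  · rfl
  · rw [MvPolynomial.homogeneousComponent_eq_zero, map_zero]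
    simpa using h

theorem ker_pullback_isHomogeneous (hr : 1 ≤ r) :
    (RingHom.ker (pullback A)).IsHomogeneous (grading K n) := by
  intro d F hF
  have : (DirectSum.decompose (grading K n) F d : MvPolynomial (Fin (n + 1)) K) =
      MvPolynomial.homogeneousComponent d F := coe_decompose_eq_homogeneousComponent F d
  rw [this, RingHom.mem_ker, ← homogeneousComponent_pullback A hr, RingHom.mem_ker.1 hF, map_zero]

/-- The generic point of the curve. -/
def genericPoint (hr : 1 ≤ r) (f : PosForm K n) (hf : pullback A f.poly ≠ 0) :
    ProjectiveSpectrum (grading K n) where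
  asHomogeneousIdeal := ⟨RingHom.ker (pullback A), ker_pullback_isHomogeneous A hr⟩
  isPrime := RingHom.ker_isPrime (pullback A)
  not_irrelevant_le h := hf (h (HomogeneousIdeal.mem_irrelevant_of_mem (grading K n) f.pos f.mem))

theorem subsingleton_locRing {f : PosForm K n} (hf : pullback A f.poly = 0) :
    Subsingleton (LocRing A f) :=
  IsLocalization.subsingleton (M := Submonoid.powers (pullback A f.poly)) ⟨1, by simp [hf]⟩

theorem mk_pullback_eq_zero_iff {f : PosForm K n} (hf : pullback A f.poly ≠ 0)
    (p : MvPolynomial (Fin 2) K) (k : ℕ) :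
    Localization.mk p (Submonoid.pow (pullback A f.poly) k) = 0 ↔ p = 0 := by
  rw [Localization.mk_eq_mk', IsLocalization.mk'_eq_zero_iff]
  constructor
  · rintro ⟨⟨_, m, rfl⟩, h⟩
    exact (mul_eq_zero.1 h).resolve_left (pow_ne_zero _ hf)
  · intro h
    exact ⟨1, by rw [h, mul_zero]⟩

/-- The kernel of `pullback A` is a homogeneous prime, the generic point of C. A fraction F/f^k that
vanishes there has F in this kernel, and then it vanishes at every point of C in D₊(f). -/
theorem mem_curve_ideal (hr : 1 ≤ r) (f : PosForm K n) (s : Γ(PSpace K n, (stdOpen f).1)) :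
    s ∈ (curve A).ideal (stdOpen f) ↔ comorphism A f s = 0 := by
  have h1 : s ∈ (curve A).ideal (stdOpen f) ↔ ∀ x : PSpace K n, x ∈ (stdOpen f).1 →
      x ∈ ProjectiveSpectrum.zeroLocus (grading K n) {F | pullback A F = 0} →
      x ∉ (PSpace K n).basicOpen s := by
    rw [curve, Scheme.IdealSheafData.vanishingIdeal_ideal, PrimeSpectrum.mem_vanishingIdeal]
    have h2 : ∀ p, (stdOpen f).2.fromSpec p ∈ (PSpace K n).basicOpen s ↔ s ∉ p.asIdeal := by
      intro p
      have := (stdOpen f).2.fromSpec_preimage_basicOpen s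
      exact congr(p ∈ $this).to_iff
    constructor
    · intro h x hx hxZ
      rw [← SetLike.mem_coe, ← (stdOpen f).2.range_fromSpec] at hx
      obtain ⟨p, rfl⟩ := hx
      rw [h2, not_not]
      exact h p hxZ
    · intro h p hp
      have := h ((stdOpen f).2.fromSpec p) (by
        rw [← SetLike.mem_coe, ← (stdOpen f).2.range_fromSpec]
        exact ⟨p, rfl⟩) hp
      exact not_not.1 fun h' => this ((h2 p).2 h')
  rw [h1]
  obtain ⟨k, F, hF, rfl⟩ := exists_frac f s
  rw [comorphism_frac]
  by_cases hf : pullback A f.poly = 0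
  -- If j^*f = 0, then C does not meet D₊(f) and K[t,u]_{j^*f} is the zero ring.
  · have := subsingleton_locRing A hf
    simp only [Subsingleton.elim _ (0 : LocRing A f), iff_true]
    exact fun x hx hxZ => (hx (hxZ hf)).elim
  · rw [mk_pullback_eq_zero_iff A hf]
    constructor
    · intro h
      by_contra hF0
      exact h (genericPoint A hr f hf) hf (fun G hG => hG)
        ((mem_basicOpen_frac f k F hF (genericPoint A hr f hf) hf).2 hF0)
    · intro h x hx hxZ
      rw [mem_basicOpen_frac f k F hF x hx, not_not]
      exact hxZ h

variable {A}

/-- An injective A has a left inverse B; row b of B gives the coefficients of the linear form. -/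
theorem exists_linear_form (hA : Function.Injective A.mulVec) {a b : ℕ} (hab : a + b = r) :
    ∃ c : Fin (n + 1) → K, pullback A (∑ i, MvPolynomial.C (c i) * MvPolynomial.X i) =
      MvPolynomial.X 0 ^ a * MvPolynomial.X 1 ^ b := by
  obtain ⟨g, hg⟩ := A.mulVecLin.exists_leftInverse_of_injective (LinearMap.ker_eq_bot.2 hA)
  obtain ⟨B, rfl⟩ := Matrix.toLin'.surjective g
  have hBA : B * A = 1 := by
    apply Matrix.toLin'.injective
    rw [Matrix.toLin'_mul, Matrix.toLin'_one]
    exact hg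
  refine ⟨B ⟨b, by omega⟩, ?_⟩
  have h : ∀ l : Fin (r + 1), ∑ i, B ⟨b, by omega⟩ i * A i l = if ⟨b, by omega⟩ = l then 1 else 0 :=
    fun l => by rw [← Matrix.mul_apply, hBA, Matrix.one_apply]
  simp only [map_sum, map_mul, pullback, MvPolynomial.aeval_X, MvPolynomial.algHom_C,
    MvPolynomial.algebraMap_eq, Finset.mul_sum]
  rw [Finset.sum_comm]
  simp only [← mul_assoc, ← map_mul, ← Finset.sum_mul, ← map_sum, h]
  rw [Finset.sum_eq_single ⟨b, by omega⟩]
  · simp [← hab]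
  · intro l _ hl
    simp [hl.symm]
  · simp

theorem linear_form_mem (c : Fin (n + 1) → K) :
    ∑ i, MvPolynomial.C (c i) * MvPolynomial.X i ∈ grading K n 1 :=
  MvPolynomial.IsHomogeneous.sum _ _ _ fun _ _ => MvPolynomial.isHomogeneous_C_mul_X _ _

/-- Projective normality of C: a monomial of degree rd is a product of d monomials of degree r, each
the pullback of a linear form. -/
theorem exists_pullback_eq (hA : Function.Injective A.mulVec) {d : ℕ}
    {p : MvPolynomial (Fin 2) K} (hp : p.IsHomogeneous (r * d)) :
    ∃ F ∈ grading K n d, pullback A F = p := by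
  refine mem_of_binary_monomials (W := (grading K n d).map (pullback A).toLinearMap) ?_ hp
  clear hp p
  induction d with
  | zero =>
    intro a b hab
    obtain ⟨rfl, rfl⟩ : a = 0 ∧ b = 0 := by omega
    exact ⟨1, MvPolynomial.isHomogeneous_one _ _, by simp⟩
  | succ d ih =>
    intro a b hab
    rw [mul_add, mul_one] at hab
    obtain ⟨a', b', ha', hb', hr'⟩ : ∃ a' b', a' ≤ a ∧ b' ≤ b ∧ a' + b' = r :=
      ⟨min a r, r - min a r, by omega, by omega, by omega⟩
    obtain ⟨F, hF, e⟩ := ih (a - a') (b - b') (by omega)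
    obtain ⟨c, hc⟩ := exists_linear_form hA hr'
    refine ⟨F * _, SetLike.mul_mem_graded hF (linear_form_mem c), ?_⟩
    have e' : pullback A F = _ := e
    change pullback A _ = _
    rw [map_mul, hc, e', mul_mul_mul_comm, ← pow_add, ← pow_add, Nat.sub_add_cancel ha',
      Nat.sub_add_cancel hb']

/-- A common factor would divide both t^r and u^r, since these are pullbacks of linear forms. -/
theorem exists_not_dvd_pullback_X (hA : Function.Injective A.mulVec)
    {π : MvPolynomial (Fin 2) K} (hπ : Irreducible π) :
    ∃ i, ¬ π ∣ pullback A (MvPolynomial.X i) := by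
  by_contra! h
  have key : ∀ a b, a + b = r → π ∣ MvPolynomial.X 0 ^ a * MvPolynomial.X 1 ^ b := by
    intro a b hab
    obtain ⟨c, hc⟩ := exists_linear_form hA hab
    rw [← hc, map_sum]
    refine Finset.dvd_sum fun i _ => ?_
    rw [map_mul]
    exact (h i).mul_left _
  have h0 : π ∣ MvPolynomial.X 0 := hπ.prime.dvd_of_dvd_pow (by simpa using key r 0 (by simp))
  have h1 : π ∣ MvPolynomial.X 1 := hπ.prime.dvd_of_dvd_pow (by simpa using key 0 r (by simp))
  have h2 := (hπ.dvd_comm (MvPolynomial.X_prime).irreducible).1 h0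
  simpa using MvPolynomial.X_dvd_X.1 (h2.trans h1)

theorem exists_pullback_X_ne_zero (hA : Function.Injective A.mulVec) :
    ∃ i, pullback A (MvPolynomial.X i) ≠ 0 := by
  obtain ⟨i, hi⟩ := exists_not_dvd_pullback_X hA
    (MvPolynomial.X_prime (R := K) (i := (0 : Fin 2))).irreducible
  exact ⟨i, fun h => hi (h ▸ dvd_zero _)⟩

end Curve

/-! ### From μ to binary forms: gluing the local values -/

section Lift

variable {K : Type u} [Field K] {n r : ℕ} {A : Matrix (Fin (n + 1)) (Fin (r + 1)) K} {b : ℤ}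

theorem frac_mul {f : PosForm K n} {k l m : ℕ} {H F G}
    (hH hF hG) (e : H * F * f.poly ^ m = G * (f.poly ^ k * f.poly ^ l)) :
    frac f k H hH * frac f l F hF = frac f m G hG := by
  have h := frac_mul_res (dvd_refl f.poly) hH hF hG e
  have h' : res (dvd_refl f.poly) (frac f l F hF) = frac f l F hF :=
    ext_valueAt fun _ _ => rfl
  rwa [h'] at h

theorem algebraMap_pow_mul_mk (f : PosForm K n) (p : MvPolynomial (Fin 2) K) (k : ℕ) :
    algebraMap _ (LocRing A f) (pullback A f.poly) ^ k *
      Localization.mk p (Submonoid.pow (pullback A f.poly) k) = algebraMap _ _ p := by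
  rw [← map_pow, Localization.mk_eq_mk']
  exact IsLocalization.mk'_spec' (LocRing A f) p (Submonoid.pow (pullback A f.poly) k)

theorem locRes_algebraMap {f g : PosForm K n} (h : f.poly ∣ g.poly)
    (p : MvPolynomial (Fin 2) K) :
    locRes A h (algebraMap _ _ p) = algebraMap _ _ p :=
  IsLocalization.Away.lift_eq _ (isUnit_of_dvd A h) p

theorem algebraMap_locRing_injective {f : PosForm K n} (hf : pullback A f.poly ≠ 0) :
    Function.Injective (algebraMap (MvPolynomial (Fin 2) K) (LocRing A f)) :=
  IsLocalization.injective _ (powers_le_nonZeroDivisors_of_noZeroDivisors hf)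

namespace ConormalMap

open Classical in
/-- The value of `μ` on a function on `D₊(f)`, extended by zero off the ideal of the curve. -/
def value (μ : ConormalMap A b) (f : PosForm K n) (s : Γ(PSpace K n, (stdOpen f).1)) :
    LocRing A f :=
  if hs : s ∈ (curve A).ideal (stdOpen f) then μ.app f (Ideal.toCotangent _ ⟨s, hs⟩) else 0

variable (μ : ConormalMap A b)

theorem value_of_mem {f : PosForm K n} {s : Γ(PSpace K n, (stdOpen f).1)}
    (hs : s ∈ (curve A).ideal (stdOpen f)) :
    μ.value f s = μ.app f (Ideal.toCotangent _ ⟨s, hs⟩) := dif_pos hs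

theorem value_add {f : PosForm K n} {s t : Γ(PSpace K n, (stdOpen f).1)}
    (hs : s ∈ (curve A).ideal (stdOpen f)) (ht : t ∈ (curve A).ideal (stdOpen f)) :
    μ.value f (s + t) = μ.value f s + μ.value f t := by
  rw [μ.value_of_mem hs, μ.value_of_mem ht, μ.value_of_mem (add_mem hs ht), ← map_add,
    ← map_add]
  rfl

theorem value_mul {f : PosForm K n} (c : Γ(PSpace K n, (stdOpen f).1))
    {s : Γ(PSpace K n, (stdOpen f).1)} (hs : s ∈ (curve A).ideal (stdOpen f)) :
    μ.value f (c * s) = comorphism A f c * μ.value f s := by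
  rw [μ.value_of_mem hs, μ.value_of_mem (Ideal.mul_mem_left _ c hs), ← smul_eq_mul (comorphism A f c),
    ← LinearMap.map_smulₛₗ, ← map_smul]
  simp only [SetLike.mk_smul_mk, smul_eq_mul]

theorem value_res {f g : PosForm K n} (h : f.poly ∣ g.poly)
    {s : Γ(PSpace K n, (stdOpen f).1)} (hs : s ∈ (curve A).ideal (stdOpen f)) :
    μ.value g (res h s) = locRes A h (μ.value f s) := by
  rw [μ.value_of_mem hs, μ.value_of_mem (res_mem (curve A) h hs), μ.naturality h]

theorem value_mem (f : PosForm K n) {s : Γ(PSpace K n, (stdOpen f).1)}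
    (hs : s ∈ (curve A).ideal (stdOpen f)) : μ.value f s ∈ twistSections A b f := by
  rw [μ.value_of_mem hs]
  exact μ.app_mem _ _

end ConormalMap

theorem mem_grading_smul {d : ℕ} {F : MvPolynomial (Fin (n + 1)) K} (hF : F ∈ grading K n d)
    (i : Fin (n + 1)) : F ∈ grading K n (d • (coord K n i).deg) := by simpa using hF

theorem frac_mem_curve_ideal (hr : 1 ≤ r) (f : PosForm K n) {k : ℕ} {F} (hF)
    (h : pullback A F = 0) : frac f k F hF ∈ (curve A).ideal (stdOpen f) := by
  rw [mem_curve_ideal A hr, comorphism_frac, h, Localization.mk_zero]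

theorem dehomogenize_mem_curve_ideal (hr : 1 ≤ r) (i : Fin (n + 1)) {d : ℕ}
    {F : MvPolynomial (Fin (n + 1)) K} (hF : F ∈ grading K n d) (h : pullback A F = 0) :
    dehomogenize F hF i ∈ (curve A).ideal (stdOpen (coord K n i)) :=
  frac_mem_curve_ideal hr (coord K n i) (mem_grading_smul hF i) h

theorem dehomogenize_add (i : Fin (n + 1)) {d : ℕ} {F G : MvPolynomial (Fin (n + 1)) K}
    (hF : F ∈ grading K n d) (hG : G ∈ grading K n d) :
    dehomogenize (F + G) (add_mem hF hG) i = dehomogenize F hF i + dehomogenize G hG i :=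
  (frac_add (coord K n i) d F G (mem_grading_smul hF i) (mem_grading_smul hG i)).symm

theorem dehomogenize_mul (i : Fin (n + 1)) {d e : ℕ} {H F : MvPolynomial (Fin (n + 1)) K}
    (hH : H ∈ grading K n d) (hF : F ∈ grading K n e) (hHF : H * F ∈ grading K n (d + e)) :
    dehomogenize (H * F) hHF i = dehomogenize H hH i * dehomogenize F hF i :=
  (frac_mul (f := coord K n i) (mem_grading_smul hH i) (mem_grading_smul hF i)
    (mem_grading_smul hHF i) (by ring)).symm

theorem comorphism_dehomogenize (i : Fin (n + 1)) {d : ℕ} {F : MvPolynomial (Fin (n + 1)) K}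
    (hF : F ∈ grading K n d) : comorphism A (coord K n i) (dehomogenize F hF i) =
      Localization.mk (pullback A F) (Submonoid.pow (pullback A (coord K n i).poly) d) :=
  comorphism_frac A (coord K n i) d F (mem_grading_smul hF i)

/-- The element `(j^* xᵢ)ᵈ μ(F / xᵢᵈ)` attached to a form `F` of degree `d`. -/
def ConormalMap.twist (μ : ConormalMap A b) (i : Fin (n + 1)) {d : ℕ}
    {F : MvPolynomial (Fin (n + 1)) K} (hF : F ∈ grading K n d) : LocRing A (coord K n i) :=
  algebraMap _ (LocRing A (coord K n i)) (pullback A (coord K n i).poly) ^ d *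
    μ.value (coord K n i) (dehomogenize F hF i)

theorem twist_add (hr : 1 ≤ r) (μ : ConormalMap A b) (i : Fin (n + 1)) {d : ℕ}
    {F G : MvPolynomial (Fin (n + 1)) K} (hF : F ∈ grading K n d) (hG : G ∈ grading K n d)
    (hF0 : pullback A F = 0) (hG0 : pullback A G = 0) :
    μ.twist i (add_mem hF hG) = μ.twist i hF + μ.twist i hG := by
  rw [ConormalMap.twist, dehomogenize_add i hF hG, μ.value_add (dehomogenize_mem_curve_ideal hr i hF hF0)
    (dehomogenize_mem_curve_ideal hr i hG hG0), mul_add]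
  rfl

/-- The product and its degree enter through equations, so that degrees such as d • 2 and d + d can
be exchanged freely. -/
theorem twist_mul (hr : 1 ≤ r) (μ : ConormalMap A b) (i : Fin (n + 1)) {d m e : ℕ}
    {H F G : MvPolynomial (Fin (n + 1)) K} (hH : H ∈ grading K n m) (hF : F ∈ grading K n d)
    (hG : G ∈ grading K n e) (hF0 : pullback A F = 0) (hGe : G = H * F) (he : e = m + d) :
    μ.twist i hG = algebraMap _ _ (pullback A H) * μ.twist i hF := by
  subst hGe he
  rw [ConormalMap.twist, ConormalMap.twist, dehomogenize_mul i hH hF,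
    μ.value_mul _ (dehomogenize_mem_curve_ideal hr i hF hF0), comorphism_dehomogenize,
    ← algebraMap_pow_mul_mk _ (pullback A H) m]
  ring

/-- With N = k deg g, F/g^k = (x_i^N/g^k)(F/x_i^N) on D₊(g); apply linearity and naturality of μ.
The left side does not involve i, which makes different charts comparable. -/
theorem pow_mul_value_frac (hr : 1 ≤ r) (μ : ConormalMap A b) {i : Fin (n + 1)}
    {g : PosForm K n} (h : (coord K n i).poly ∣ g.poly) {k : ℕ}
    {F : MvPolynomial (Fin (n + 1)) K} (hF : F ∈ grading K n (k • g.deg))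
    (hF0 : pullback A F = 0) :
    algebraMap _ _ (pullback A g.poly) ^ k * μ.value g (frac g k F hF) =
      locRes A h (μ.twist i hF) := by
  have hX : (coord K n i).poly ^ (k • g.deg) ∈ grading K n (k • g.deg) := by
    simpa using SetLike.pow_mem_graded (k • g.deg) (coord K n i).mem
  have e : frac g k F hF = frac g k ((coord K n i).poly ^ (k • g.deg)) hX *
      res h (dehomogenize F hF i) :=
    (frac_mul_res h hX (mem_grading_smul hF i) hF (by ring)).symm
  have hm := dehomogenize_mem_curve_ideal hr i hF hF0
  rw [e, μ.value_mul _ (res_mem _ h hm), μ.value_res h hm, comorphism_frac,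
    ← mul_assoc, algebraMap_pow_mul_mk, ConormalMap.twist, map_mul, map_pow, map_pow, map_pow,
    locRes_algebraMap]

/-- The product of two coordinates. -/
def coordMul (K : Type u) [Field K] (n : ℕ) (i j : Fin (n + 1)) : PosForm K n where
  deg := 2
  poly := MvPolynomial.X i * MvPolynomial.X j
  mem := SetLike.mul_mem_graded (coord K n i).mem (coord K n j).mem
  pos := two_pos

theorem coord_dvd_coordMul_left (i j : Fin (n + 1)) :
    (coord K n i).poly ∣ (coordMul K n i j).poly :=
  Dvd.intro _ rfl

theorem coord_dvd_coordMul_right (i j : Fin (n + 1)) :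
    (coord K n j).poly ∣ (coordMul K n i j).poly :=
  Dvd.intro_left _ rfl

theorem locRes_twist_eq (hr : 1 ≤ r) (μ : ConormalMap A b) (i j : Fin (n + 1)) {d : ℕ}
    {F : MvPolynomial (Fin (n + 1)) K} (hF : F ∈ grading K n d) (hF0 : pullback A F = 0) :
    locRes A (coord_dvd_coordMul_left i j) (μ.twist i hF) =
      locRes A (coord_dvd_coordMul_right i j) (μ.twist j hF) := by
  have hX : (coord K n j).poly ^ d ∈ grading K n d := by
    simpa using SetLike.pow_mem_graded d (coord K n j).mem
  -- The degree d of F may be odd, while x_i x_j has degree 2. The factor x_j^d brings the degree to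
  -- 2d; its pullback is a unit over D₊(x_i x_j) and is cancelled at the end.
  have hG : (coord K n j).poly ^ d * F ∈ grading K n (d • (coordMul K n i j).deg) := by
    have : d • (coordMul K n i j).deg = d + d := mul_two d
    rw [this]
    exact SetLike.mul_mem_graded hX hF
  have hG0 : pullback A ((coord K n j).poly ^ d * F) = 0 := by rw [map_mul, hF0, mul_zero]
  have e1 := pow_mul_value_frac hr μ (coord_dvd_coordMul_left i j) hG hG0
  have e2 := pow_mul_value_frac hr μ (coord_dvd_coordMul_right i j) hG hG0
  rw [e1, twist_mul hr μ i hX hF hG hF0 rfl (mul_two d), twist_mul hr μ j hX hF hG hF0 rfl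
    (mul_two d), map_mul, map_mul, locRes_algebraMap, locRes_algebraMap, map_pow, map_pow] at e2
  exact ((isUnit_of_dvd A (coord_dvd_coordMul_right i j)).pow d).mul_left_cancel e2

/-- The section `q` of `𝒪_{ℙ¹}(b + r d)` induced by the form `F` of degree `d` which vanishes on
the curve. -/
def ConormalMap.Lifts (μ : ConormalMap A b) (d : ℕ) (F : MvPolynomial (Fin (n + 1)) K)
    (q : MvPolynomial (Fin 2) K) : Prop :=
  pullback A F = 0 ∧ ∃ hF : F ∈ grading K n d, ∀ i, μ.twist i hF = algebraMap _ _ q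

/-- The twisted values are fractions with denominators powers of the j^*x_i and agree on overlaps,
so `exists_eq_mul_pow_of_agree` yields one polynomial. -/
theorem exists_lifts (hr : 1 ≤ r) (hA : Function.Injective A.mulVec) (μ : ConormalMap A b) {d : ℕ}
    {F : MvPolynomial (Fin (n + 1)) K} (hF : F ∈ grading K n d) (hF0 : pullback A F = 0) :
    ∃ q, μ.Lifts d F q ∧ (q = 0 ∨ ∃ e : ℕ, (e : ℤ) = b + r * d ∧ q.IsHomogeneous e) := by
  have h1 : ∀ i, ∃ (k e : ℕ) (p : MvPolynomial (Fin 2) K), p.IsHomogeneous e ∧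
      (e : ℤ) = b + r * d + k * r ∧ algebraMap _ _ (pullback A (MvPolynomial.X i)) ^ k *
        μ.twist i hF = algebraMap _ _ p := by
    intro i
    obtain ⟨k, e, p, hp, he, h⟩ := μ.value_mem _
      (frac_mem_curve_ideal (A := A) hr (coord K n i) (mem_grading_smul hF i) hF0)
    refine ⟨k, e + r * d, p * pullback A (MvPolynomial.X i) ^ d, hp.mul ?_, ?_, ?_⟩
    · simpa using (pullback_isHomogeneous A (coord K n i).mem).pow d
    · push_cast
      rw [he]
      push_cast
      ring
    · have h' : μ.value (coord K n i) (dehomogenize F hF i) = _ := h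
      rw [ConormalMap.twist, h', map_mul, ← algebraMap_pow_mul_mk (coord K n i) p k, map_pow]
      ring
  choose k e p hp he h using h1
  obtain ⟨i₀, h₀⟩ := exists_pullback_X_ne_zero hA
  obtain ⟨q, hq⟩ := exists_eq_mul_pow_of_agree (fun i => pullback A (MvPolynomial.X i)) p k i₀ h₀
    (fun π hπ => exists_not_dvd_pullback_X hA hπ) (by
      intro i j hi hj
      have hij : pullback A (coordMul K n i j).poly ≠ 0 := by
        rw [coordMul, map_mul]
        exact mul_ne_zero hi hj
      apply algebraMap_locRing_injective hij
      have ei := congr(locRes A (coord_dvd_coordMul_left i j) $(h i))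
      have ej := congr(locRes A (coord_dvd_coordMul_right i j) $(h j))
      rw [map_mul, map_pow, locRes_algebraMap, locRes_algebraMap] at ei ej
      rw [← locRes_twist_eq hr μ i j hF hF0] at ej
      rw [map_mul, map_mul, ← ei, ← ej, map_pow, map_pow]
      ring)
  refine ⟨q, ⟨hF0, hF, fun i => ?_⟩, ?_⟩
  · by_cases hi : pullback A (MvPolynomial.X i) = 0
    · have := subsingleton_locRing A (f := coord K n i) hi
      exact Subsingleton.elim _ _
    · have hu := (isUnit_of_dvd A (dvd_refl (coord K n i).poly)).pow (k i)
      apply hu.mul_left_cancel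
      rw [h i, hq i hi, map_mul, map_pow]
      ring
  · have hX : (pullback A (MvPolynomial.X i₀) ^ k i₀).IsHomogeneous (r * k i₀) := by
      simpa using (pullback_isHomogeneous A (coord K n i₀).mem).pow (k i₀)
    rcases exists_isHomogeneous_of_mul hX (pow_ne_zero _ h₀) (hq i₀ h₀ ▸ hp i₀) with h | ⟨m, hm, h⟩
    · exact Or.inl h
    · refine Or.inr ⟨m, ?_, h⟩
      have := he i₀
      rw [← hm] at this
      push_cast at this
      linarith

end Lift

/-! ### Surjectivity on forms of large degree -/

section Surjective

variable {K : Type u} [Field K] {n r : ℕ} {A : Matrix (Fin (n + 1)) (Fin (r + 1)) K} {b : ℤ}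

theorem lifts_add (hr : 1 ≤ r) {μ : ConormalMap A b} {d : ℕ} {F G p q} (hF : μ.Lifts d F p)
    (hG : μ.Lifts d G q) : μ.Lifts d (F + G) (p + q) := by
  obtain ⟨hF0, hF, hF'⟩ := hF
  obtain ⟨hG0, hG, hG'⟩ := hG
  exact ⟨by rw [map_add, hF0, hG0, add_zero], add_mem hF hG, fun i => by
    rw [twist_add hr μ i hF hG hF0 hG0, hF', hG', map_add]⟩

theorem lifts_mul (hr : 1 ≤ r) {μ : ConormalMap A b} {d m e : ℕ} {H F q}
    (hH : H ∈ grading K n m) (hF : μ.Lifts d F q) (he : e = m + d) :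
    μ.Lifts e (H * F) (pullback A H * q) := by
  obtain ⟨hF0, hF, hF'⟩ := hF
  have hG : H * F ∈ grading K n e := he ▸ SetLike.mul_mem_graded hH hF
  exact ⟨by rw [map_mul, hF0, mul_zero], hG, fun i => by
    rw [twist_mul hr μ i hH hF hG hF0 rfl he, hF', map_mul]⟩

theorem lifts_smul (hr : 1 ≤ r) {μ : ConormalMap A b} {d : ℕ} {F q} (c : K)
    (hF : μ.Lifts d F q) : μ.Lifts d (c • F) (c • q) := by
  have := lifts_mul hr (MvPolynomial.isHomogeneous_C _ c) hF (zero_add d).symm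
  rwa [pullback, MvPolynomial.algHom_C, MvPolynomial.algebraMap_eq, MvPolynomial.C_mul',
    MvPolynomial.C_mul'] at this

theorem lifts_zero (hr : 1 ≤ r) (hA : Function.Injective A.mulVec) (μ : ConormalMap A b) (d : ℕ) :
    μ.Lifts d 0 0 := by
  obtain ⟨q, hq, -⟩ := exists_lifts hr hA μ (zero_mem (grading K n d)) (map_zero (pullback A))
  simpa using lifts_smul hr (0 : K) hq

/-- The sections of `𝒪_{ℙ¹}(b + r d)` induced by forms of degree `d` which vanish on the curve. -/
def liftedSections (hr : 1 ≤ r) (hA : Function.Injective A.mulVec) (μ : ConormalMap A b) (d : ℕ) :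
    Submodule K (MvPolynomial (Fin 2) K) where
  carrier := {q | ∃ F, μ.Lifts d F q}
  zero_mem' := ⟨0, lifts_zero hr hA μ d⟩
  add_mem' := fun ⟨F, hF⟩ ⟨G, hG⟩ => ⟨F + G, lifts_add hr hF hG⟩
  smul_mem' := fun c _ ⟨F, hF⟩ => ⟨c • F, lifts_smul hr c hF⟩

/-- The forms of degree `m` which multiply `z` into the lifted sections of degree `m + t`. -/
def multipliers (hr : 1 ≤ r) (hA : Function.Injective A.mulVec) (μ : ConormalMap A b) (t : ℕ)
    (z : MvPolynomial (Fin 2) K) (m : ℕ) : Submodule K (MvPolynomial (Fin (n + 1)) K) :=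
  grading K n m ⊓ (liftedSections hr hA μ (m + t)).comap
    ((LinearMap.mulRight K z).comp (pullback A).toLinearMap)

theorem mem_multipliers {hr : 1 ≤ r} {hA : Function.Injective A.mulVec} {μ : ConormalMap A b}
    {t m : ℕ} {z h} : h ∈ multipliers hr hA μ t z m ↔
      h ∈ grading K n m ∧ ∃ F, μ.Lifts (m + t) F (pullback A h * z) := Iff.rfl

theorem mul_mem_multipliers {hr : 1 ≤ r} {hA : Function.Injective A.mulVec} {μ : ConormalMap A b}
    {t k m : ℕ} {z h F} (hh : h ∈ grading K n k) (hF : F ∈ multipliers hr hA μ t z m) :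
    h * F ∈ multipliers hr hA μ t z (k + m) := by
  rw [mem_multipliers] at hF ⊢
  obtain ⟨hF, G, hG⟩ := hF
  refine ⟨SetLike.mul_mem_graded hh hF, h * G, ?_⟩
  rw [map_mul, mul_assoc]
  exact lifts_mul hr hh hG (add_assoc k m t)

/-- A homogeneous prime that contains all multipliers but not x_i is a point of D₊(x_i). Near it, on
some D₊(g), the section z/(j^*x_i)^t lifts to F/g^k. Clearing denominators makes a power of g a
multiplier, so g lies in the prime: a contradiction. -/
theorem X_mem_radical (hr : 1 ≤ r) (hA : Function.Injective A.mulVec) {μ : ConormalMap A b}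
    (hμ : μ.IsSurjective) {t e : ℕ} (he : (e : ℤ) = b + r * t) {z : MvPolynomial (Fin 2) K}
    (hz : z.IsHomogeneous e) (i : Fin (n + 1)) :
    MvPolynomial.X i ∈ (Ideal.span {h | ∃ m, h ∈ multipliers hr hA μ t z m}).radical := by
  have hJ : (Ideal.span {h | ∃ m, h ∈ multipliers hr hA μ t z m}).IsHomogeneous (grading K n) :=
    Ideal.homogeneous_span _ _ fun h ⟨m, hm⟩ => ⟨m, hm.1⟩
  rw [hJ.radical_eq]
  refine (Submodule.mem_sInf).2 ?_
  rintro Q ⟨hQ, hJQ, hQp⟩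
  by_contra hX
  let x : ProjectiveSpectrum (grading K n) := ⟨⟨Q, hQ⟩, hQp, fun h =>
    hX (h (HomogeneousIdeal.mem_irrelevant_of_mem (grading K n) (coord K n i).pos
      (coord K n i).mem))⟩
  obtain ⟨g, hg, hxg, s, hs⟩ := hμ (coord K n i)
    (Localization.mk z (Submonoid.pow (pullback A (coord K n i).poly) t))
    ⟨t, e, z, hz, by rw [he]; push_cast; ring, rfl⟩ x hX
  obtain ⟨⟨s, hs'⟩, rfl⟩ := Ideal.toCotangent_surjective _ s
  obtain ⟨k, F, hF, rfl⟩ := exists_frac g s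
  rw [← μ.value_of_mem hs'] at hs
  by_cases hg0 : pullback A g.poly = 0
  -- If j^*g = 0, denominators cannot be cleared, but g is a multiplier itself: j^*g · z = 0 is
  -- induced by the zero form.
  · refine hxg (hJQ (Ideal.subset_span ⟨g.deg, mem_multipliers.2 ⟨g.mem, 0, ?_⟩⟩))
    rw [hg0, zero_mul]
    exact lifts_zero hr hA μ _
  · have hF0 : pullback A F = 0 := by
      rwa [mem_curve_ideal A hr, comorphism_frac, mk_pullback_eq_zero_iff A hg0] at hs'
    obtain ⟨q, hq, -⟩ := exists_lifts hr hA μ hF hF0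
    have e1 := pow_mul_value_frac hr μ hg hF hF0
    rw [hs, hq.2.choose_spec i, locRes_algebraMap] at e1
    have e2 := congr(locRes A hg $(algebraMap_pow_mul_mk (A := A) (coord K n i) z t))
    rw [map_mul, map_pow, locRes_algebraMap, locRes_algebraMap] at e2
    have e3 : pullback A (g.poly ^ k) * z = pullback A ((coord K n i).poly ^ t) * q := by
      apply algebraMap_locRing_injective hg0
      rw [map_mul, map_mul, ← e1, ← e2, map_pow, map_pow, map_pow, map_pow]
      ring
    have hX : (coord K n i).poly ^ t ∈ grading K n t := by
      simpa using SetLike.pow_mem_graded t (coord K n i).mem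
    have h : g.poly ^ k ∈ multipliers hr hA μ t z (k • g.deg) := by
      refine mem_multipliers.2 ⟨SetLike.pow_mem_graded k g.mem,
        (coord K n i).poly ^ t * F, ?_⟩
      rw [e3]
      exact lifts_mul hr hX hq (add_comm _ _)
    exact hxg (hQp.mem_of_pow_mem k (hJQ (Ideal.subset_span ⟨_, h⟩)))

theorem exists_forall_mem_multipliers (hr : 1 ≤ r) (hA : Function.Injective A.mulVec)
    {μ : ConormalMap A b} (hμ : μ.IsSurjective) {t e : ℕ} (he : (e : ℤ) = b + r * t)
    {z : MvPolynomial (Fin 2) K} (hz : z.IsHomogeneous e) :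
    ∃ N, ∀ m, N ≤ m → ∀ h ∈ grading K n m, h ∈ multipliers hr hA μ t z m := by
  choose k hk using fun i => Ideal.mem_radical_iff.1 (X_mem_radical hr hA hμ he hz i)
  have hk' : ∀ i, MvPolynomial.X i ^ Finset.univ.sup k ∈
      Ideal.span {h | ∃ m, h ∈ multipliers hr hA μ t z m} := fun i =>
    Ideal.pow_mem_of_pow_mem _ (hk i) (Finset.le_sup (Finset.mem_univ i))
  refine ⟨Fintype.card (Fin (n + 1)) * Finset.univ.sup k + 1, fun m hm h hh => ?_⟩
  -- Multipliers are closed under multiplication by forms, so a form in the ideal they generate is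
  -- itself a multiplier.
  exact mem_of_mem_span (fun _ => inf_le_left) (fun _ _ _ _ h₁ h₂ => mul_mem_multipliers h₁ h₂) hh
    (mem_of_X_pow_mem hk' hm hh)

/-- Fix t₀ with e₀ = b + r t₀ ≥ 0. A monomial of degree e₀ + rm is one of the finitely many
monomials of degree e₀ times the pullback of a form of degree m, and for large m every such form is
a multiplier. -/
theorem exists_forall_exists_lifts (hr : 1 ≤ r) (hA : Function.Injective A.mulVec)
    {μ : ConormalMap A b} (hμ : μ.IsSurjective) :
    ∃ N : ℕ, ∀ t, N ≤ t → ∀ (e : ℕ) (q : MvPolynomial (Fin 2) K), (e : ℤ) = b + r * t →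
      q.IsHomogeneous e → ∃ F, μ.Lifts t F q := by
  obtain ⟨t₀, e₀, he₀⟩ : ∃ t₀ e₀ : ℕ, (e₀ : ℤ) = b + r * t₀ := by
    -- As r ≥ 1, t₀ = |b| gives b + r t₀ ≥ 0.
    refine ⟨b.natAbs, (b + r * b.natAbs).toNat, Int.toNat_of_nonneg ?_⟩
    have : (1 : ℤ) ≤ r := by exact_mod_cast hr
    have h1 : (b.natAbs : ℤ) ≤ r * b.natAbs := le_mul_of_one_le_left (by positivity) this
    omega
  have h : ∀ a : ℕ, ∃ N, a ≤ e₀ → ∀ m, N ≤ m → ∀ h ∈ grading K n m, h ∈ multipliers hr hA μ t₀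
      (MvPolynomial.X 0 ^ a * MvPolynomial.X 1 ^ (e₀ - a)) m := by
    intro a
    by_cases ha : a ≤ e₀
    · have hz := isHomogeneous_binary_monomial (K := K) a (e₀ - a)
      rw [Nat.add_sub_cancel' ha] at hz
      obtain ⟨N, hN⟩ := exists_forall_mem_multipliers hr hA hμ he₀ hz
      exact ⟨N, fun _ => hN⟩
    · exact ⟨0, fun h => absurd h ha⟩
  choose N hN using h
  refine ⟨t₀ + (Finset.range (e₀ + 1)).sup N, fun t ht e q he hq => ?_⟩
  obtain ⟨m, rfl⟩ := Nat.exists_eq_add_of_le' (le_trans (Nat.le_add_right _ _) ht)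
  have hem : e = e₀ + r * m := by
    zify
    rw [he, he₀]
    push_cast
    ring
  refine mem_of_binary_monomials (W := liftedSections hr hA μ (m + t₀)) ?_ hq
  intro a c hac
  obtain ⟨a', ha, hc, ha'⟩ : ∃ a', a' ≤ a ∧ e₀ - a' ≤ c ∧ a' ≤ e₀ :=
    ⟨min a e₀, by omega, by omega, by omega⟩
  have hp := isHomogeneous_binary_monomial (K := K) (a - a') (c - (e₀ - a'))
  have hs : a - a' + (c - (e₀ - a')) = r * m := by omega
  rw [hs] at hp
  obtain ⟨h, hh, e⟩ := exists_pullback_eq hA hp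
  have hNa : N a' ≤ (Finset.range (e₀ + 1)).sup N :=
    Finset.le_sup (Finset.mem_range.2 (by omega))
  have := (hN a' ha' m (by omega) h hh).2
  change pullback A h * _ ∈ liftedSections hr hA μ (m + t₀) at this
  rwa [e, mul_mul_mul_comm, ← pow_add, ← pow_add, Nat.sub_add_cancel ha,
    Nat.sub_add_cancel hc] at this

end Surjective

/-! ### The saturated ideal and the dimension count -/

section Hilbert

variable {K : Type u} [Field K] {n r : ℕ} {A : Matrix (Fin (n + 1)) (Fin (r + 1)) K} {b : ℤ}

theorem lifts_unique (hA : Function.Injective A.mulVec) {μ : ConormalMap A b} {d : ℕ} {F p q}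
    (hp : μ.Lifts d F p) (hq : μ.Lifts d F q) : p = q := by
  obtain ⟨i, hi⟩ := exists_pullback_X_ne_zero hA
  obtain ⟨_, _, hp⟩ := hp
  obtain ⟨_, _, hq⟩ := hq
  exact algebraMap_locRing_injective (f := coord K n i) hi ((hp i).symm.trans (hq i))

/-- The map `H⁰(𝓘_C(d)) → H⁰(𝒪_{ℙ¹}(b + r d))` induced by `μ`. -/
def liftMap (hr : 1 ≤ r) (hA : Function.Injective A.mulVec) (μ : ConormalMap A b) (d : ℕ) :
    ↥(grading K n d ⊓ LinearMap.ker (pullback A).toLinearMap) →ₗ[K] MvPolynomial (Fin 2) K :=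
  have h (F : ↥(grading K n d ⊓ LinearMap.ker (pullback A).toLinearMap)) :=
    (exists_lifts hr hA μ F.2.1 F.2.2).choose_spec.1
  { toFun F := (exists_lifts hr hA μ F.2.1 F.2.2).choose
    map_add' F G := lifts_unique hA (h (F + G)) (lifts_add hr (h F) (h G))
    map_smul' c F := lifts_unique hA (h (c • F)) (lifts_smul hr c (h F)) }

theorem lifts_liftMap (hr : 1 ≤ r) (hA : Function.Injective A.mulVec) (μ : ConormalMap A b)
    (d : ℕ) (F : ↥(grading K n d ⊓ LinearMap.ker (pullback A).toLinearMap)) :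
    μ.Lifts d F (liftMap hr hA μ d F) :=
  (exists_lifts hr hA μ F.2.1 F.2.2).choose_spec.1

theorem range_liftMap (hr : 1 ≤ r) (hA : Function.Injective A.mulVec) {μ : ConormalMap A b}
    {t e : ℕ} (he : (e : ℤ) = b + r * t) (h : ∀ q : MvPolynomial (Fin 2) K, q.IsHomogeneous e →
      ∃ F, μ.Lifts t F q) :
    LinearMap.range (liftMap hr hA μ t) = MvPolynomial.homogeneousSubmodule (Fin 2) K e := by
  apply le_antisymm
  · rintro _ ⟨F, rfl⟩
    rcases (exists_lifts hr hA μ F.2.1 F.2.2).choose_spec.2 with h' | ⟨e', he', h'⟩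
    · change (exists_lifts hr hA μ F.2.1 F.2.2).choose ∈ _
      rw [h']
      exact zero_mem _
    · obtain rfl : e' = e := by omega
      exact h'
  · intro q hq
    obtain ⟨F, hF⟩ := h q hq
    exact ⟨⟨F, hF.2.choose, hF.1⟩, lifts_unique hA (lifts_liftMap hr hA μ t _) hF⟩

theorem lifts_zero_iff (hr : 1 ≤ r) (hA : Function.Injective A.mulVec) {μ : ConormalMap A b}
    {X : (PSpace K n).IdealSheafData} (hX : μ.Defines X) {d : ℕ}
    {F : MvPolynomial (Fin (n + 1)) K} (hF : F ∈ grading K n d) :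
    (∀ i, dehomogenize F hF i ∈ X.ideal (stdOpen (coord K n i))) ↔ μ.Lifts d F 0 := by
  constructor
  · intro h
    obtain ⟨i₀, h₀⟩ := exists_pullback_X_ne_zero hA
    refine ⟨?_, hF, fun i => ?_⟩
    · obtain ⟨hs, -⟩ := (hX _ _).1 (h i₀)
      have hs' := (mem_curve_ideal A hr _ _).1 hs
      rw [comorphism_dehomogenize] at hs'
      exact (mk_pullback_eq_zero_iff A (f := coord K n i₀) h₀ _ _).1 hs'
    · obtain ⟨hs, h'⟩ := (hX _ _).1 (h i)
      rw [← μ.value_of_mem hs] at h'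
      rw [ConormalMap.twist, h', mul_zero, map_zero]
  · rintro ⟨hF0, _, h⟩ i
    have hs := dehomogenize_mem_curve_ideal hr i hF hF0
    refine (hX _ _).2 ⟨hs, ?_⟩
    rw [← μ.value_of_mem hs]
    have hu := (isUnit_of_dvd A (dvd_refl (coord K n i).poly)).pow d
    -- The factor (j^*x_i)^d is a unit over D₊(x_i), so a twisted value vanishes only if the value
    -- of μ does.
    apply hu.mul_left_cancel
    rw [mul_zero]
    exact (h i).trans (map_zero _)

/-- The generators of degree m already form a subspace, and multiplication by forms preserves the
family, so the ideal they generate has no further forms. -/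
theorem mem_saturatedIdeal (hr : 1 ≤ r) (hA : Function.Injective A.mulVec) {μ : ConormalMap A b}
    {X : (PSpace K n).IdealSheafData} (hX : μ.Defines X) {d : ℕ}
    {F : MvPolynomial (Fin (n + 1)) K} (hF : F ∈ grading K n d) :
    F ∈ saturatedIdeal X ↔ μ.Lifts d F 0 := by
  let V (m : ℕ) : Submodule K (MvPolynomial (Fin (n + 1)) K) :=
    { carrier := {F | μ.Lifts m F 0}
      zero_mem' := lifts_zero hr hA μ m
      add_mem' := fun hF hG => by simpa using lifts_add hr hF hG
      smul_mem' := fun c _ hF => by simpa using lifts_smul hr c hF }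
  have hV : saturatedIdeal X = Ideal.span {F | ∃ d, F ∈ V d} := by
    rw [saturatedIdeal]
    congr 1
    ext G
    exact exists_congr fun m => ⟨fun ⟨hG, h⟩ => (lifts_zero_iff hr hA hX hG).1 h,
      fun h => ⟨h.2.choose, (lifts_zero_iff hr hA hX _).2 h⟩⟩
  rw [hV]
  constructor
  · refine mem_of_mem_span (V := V) (fun m G hG => hG.2.choose) (fun k m h G hh hG => ?_) hF
    have := lifts_mul hr hh hG rfl
    rwa [mul_zero] at this
  · exact fun h => Ideal.subset_span ⟨d, h⟩

theorem finrank_map_add_finrank_inf_ker {E E' : Type*} [AddCommGroup E] [Module K E]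
    [AddCommGroup E'] [Module K E'] (V : Submodule K E) [FiniteDimensional K V]
    (f : E →ₗ[K] E') :
    Module.finrank K (V.map f) + Module.finrank K ↥(V ⊓ LinearMap.ker f) = Module.finrank K V := by
  rw [← (f.domRestrict V).finrank_range_add_finrank_ker, LinearMap.range_domRestrict,
    LinearMap.ker_domRestrict, ← Submodule.finrank_map_subtype_eq V, Submodule.map_comap_subtype]

theorem map_pullback_grading (hA : Function.Injective A.mulVec) (t : ℕ) :
    (grading K n t).map (pullback A).toLinearMap =
      MvPolynomial.homogeneousSubmodule (Fin 2) K (r * t) := by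
  apply le_antisymm
  · rintro _ ⟨F, hF, rfl⟩
    exact pullback_isHomogeneous A hF
  · intro p hp
    exact exists_pullback_eq hA hp

/-- Rank-nullity three times, for R_t → (R/I_X)_t, R_t → S_{rt} and (I_C)_t → S_e. The first and the
third have the same kernel (I_X)_t, which cancels. -/
theorem hilbertFunction_eq (hr : 1 ≤ r) (hA : Function.Injective A.mulVec) {μ : ConormalMap A b}
    {X : (PSpace K n).IdealSheafData} (hX : μ.Defines X) {t e : ℕ} (he : (e : ℤ) = b + r * t)
    (h : ∀ q : MvPolynomial (Fin 2) K, q.IsHomogeneous e → ∃ F, μ.Lifts t F q) :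
    hilbertFunction X t = (r * t + 1) + (e + 1) := by
  have : FiniteDimensional K (grading K n t) :=
    Module.Finite.iff_fg.2 (MvPolynomial.homogeneousSubmodule_fg _ _ _)
  have h1 := finrank_map_add_finrank_inf_ker (grading K n t)
    (Ideal.Quotient.mkₐ K (saturatedIdeal X)).toLinearMap
  have h2 := finrank_map_add_finrank_inf_ker (grading K n t) (pullback A).toLinearMap
  have h3 := (liftMap hr hA μ t).finrank_range_add_finrank_ker
  rw [map_pullback_grading hA, finrank_binary_forms] at h2
  rw [range_liftMap hr hA he h, finrank_binary_forms, ← Submodule.finrank_map_subtype_eq] at h3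
  have h4 : (LinearMap.ker (liftMap hr hA μ t)).map (Submodule.subtype _) =
      grading K n t ⊓ LinearMap.ker (Ideal.Quotient.mkₐ K (saturatedIdeal X)).toLinearMap := by
    have hI (F : MvPolynomial (Fin (n + 1)) K) :
        F ∈ LinearMap.ker (Ideal.Quotient.mkₐ K (saturatedIdeal X)).toLinearMap ↔
          F ∈ saturatedIdeal X := Ideal.Quotient.eq_zero_iff_mem
    ext F
    rw [Submodule.mem_inf, hI]
    constructor
    · rintro ⟨F, hF, rfl⟩
      refine ⟨F.2.1, (mem_saturatedIdeal hr hA hX F.2.1).2 ?_⟩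
      have := lifts_liftMap hr hA μ t F
      rwa [hF] at this
    · rintro ⟨hF, hFI⟩
      have hF0 := (mem_saturatedIdeal hr hA hX hF).1 hFI
      exact ⟨⟨F, hF, hF0.1⟩, lifts_unique hA (lifts_liftMap hr hA μ t _) hF0, rfl⟩
  rw [h4] at h3
  rw [hilbertFunction]
  omega

end Hilbert

end DoubleRNC

end

/-! ### The Hilbert polynomial and the genus -/

theorem mainTheorem12 {K : Type u} [Field K] [IsAlgClosed K] [CharZero K] {n r : ℕ} (hr : 1 ≤ r)
    (A : Matrix (Fin (n + 1)) (Fin (r + 1)) K) (hA : Function.Injective A.mulVec) (a : ℤ)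
    (μ : DoubleRNC.ConormalMap A (-(r : ℤ) - 2 + a)) (hμ : μ.IsSurjective)
    (X : (DoubleRNC.PSpace K n).IdealSheafData) (hX : μ.Defines X) :
    DoubleRNC.IsHilbertPolynomial X
        (Polynomial.C (2 * r : ℚ) * Polynomial.X + Polynomial.C ((a : ℚ) - r)) ∧
      DoubleRNC.IsArithmeticGenus X ((r : ℤ) + 1 - a) := by
  have key : DoubleRNC.IsHilbertPolynomial X
      (Polynomial.C (2 * r : ℚ) * Polynomial.X + Polynomial.C ((a : ℚ) - r)) := by
    obtain ⟨N, hN⟩ := DoubleRNC.exists_forall_exists_lifts hr hA hμ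
    -- Besides surjectivity, t ≥ |b| is needed so that b + rt ≥ 0 and the binary forms of that
    -- degree have dimension b + rt + 1.
    refine ⟨max N (-(r : ℤ) - 2 + a).natAbs, fun t ht => ?_⟩
    obtain ⟨e, he⟩ : ∃ e : ℕ, (e : ℤ) = -(r : ℤ) - 2 + a + r * t := by
      refine ⟨_, Int.toNat_of_nonneg ?_⟩
      have h1 : (1 : ℤ) ≤ r := by exact_mod_cast hr
      have h2 : (t : ℤ) ≤ r * t := le_mul_of_one_le_left (by positivity) h1
      have h3 := le_trans (le_max_right _ _) ht
      omega
    rw [DoubleRNC.hilbertFunction_eq hr hA hX he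
      fun q hq => hN t (le_trans (le_max_left _ _) ht) e q he hq]
    have he' : (e : ℚ) = -(r : ℚ) - 2 + a + r * t := by exact_mod_cast he
    simp only [Polynomial.eval_add, Polynomial.eval_mul, Polynomial.eval_C, Polynomial.eval_X]
    push_cast
    rw [he']
    ring
  refine ⟨key, 2 * r, ?_⟩
  have h1 : ((2 * r : ℤ) : ℚ) = 2 * r := by push_cast; rfl
  have h2 : (1 - ((r + 1 - a : ℤ) : ℚ)) = a - r := by push_cast; ring
  rwa [h1, h2]
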